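/- Let $f(x)=x^8+ax^4+b\in\mathbb{Q}[x]$ be irreducible over $\mathbb{Q}$, where $b$ is the square of a rational number, and regard $\mathrm{Gal}(f)$, the Galois group of $f$ over $\mathbb{Q}$, as a group of permutations of the eight complex roots of $f$. Write 8T$j$ for the $j$-th conjugacy class of transitive subgroups of the symmetric group $S_8$ in the numbering of Butler and McKay. Then, for a suitable numbering of the roots by $1,\dots,8$, $\mathrm{Gal}(f)$ is one of the following groups: - 8T2 $=\langle (1\,2\,3\,8)(4\,5\,6\,7),\ (1\,5)(2\,6)(3\,7)(4\,8)\rangle\cong C_4\times C_2$; - 8T3 $=\langle (1\,8)(2\,3)(4\,5)(6\,7),\ (1\,3)(2\,8)(4\,6)(5\,7),\ (1\,5)(2\,6)(3\,7)(4\,8)\rangle\cong C_2^3$; - 8T4 $=\langle (1\,2\,3\,8)(4\,5\,6\,7),\ (1\,6)(2\,5)(3\,4)(7\,8)\rangle$, the dihedral group of order $8$ in its regular representation; - 8T9 $=\langle \text{8T3},\ (4\,5)(6\,7)\rangle\cong D_4\times C_2$, of order $16$; - 8T11 $=\langle (1\,5)(3\,7),\ (1\,3\,5\,7)(2\,4\,6\,8),\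 (1\,4\,5\,8)(2\,3\,6\,7)\rangle\cong C_4\circ D_4$, of order $16$; - 8T22 $=\langle \text{8T3},\ (2\,3)(4\,5),\ (2\,3)(6\,7)\rangle\cong D_4\circ D_4$, of order $32$. Here $D_4$ is the dihedral group of order $8$ and $\circ$ is the central product. In particular, $\mathrm{Gal}(f)$ is never 8T5 $=\langle (1\,2\,3\,8)(4\,5\,6\,7),\ (1\,7\,3\,5)(2\,6\,8\,4)\rangle$, the quaternion group of order $8$ in its regular representation. Moreover, each of the six groups 8T2, 8T3, 8T4, 8T9, 8T11 and 8T22 is the Galois group of some such polynomial $f$. -/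

import Mathlib

open scoped Polynomial

attribute [local instance] Polynomial.Gal.splits_ℚ_ℂ

/-- The Galois group over `ℚ` of a polynomial `f`, as a group of permutations of the set of complex
roots of `f`. -/
noncomputable def galPermGroup (f : ℚ[X]) : Subgroup (Equiv.Perm (f.rootSet ℂ)) :=
  (Polynomial.Gal.galActionHom f ℂ).range

/-- `GalIs f T` says that the Galois group of `f` over `ℚ` belongs to the conjugacy class of the
subgroup `T` of the symmetric group on `n` letters: for a suitable numbering `e` of the roots of `f`
by the `n` letters, the Galois group is `T`. (Changing the numbering replaces `T` by a conjugate.) -/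
def GalIs {n : ℕ} (f : ℚ[X]) (T : Subgroup (Equiv.Perm (Fin n))) : Prop :=
  ∃ e : f.rootSet ℂ ≃ Fin n, (galPermGroup f).map e.permCongrHom.toMonoidHom = T

/-! Representatives of the conjugacy classes 8T2, 8T3, 8T4, 8T5, 8T9, 8T11 and 8T22 of transitive
permutation groups of degree eight, in the numbering of Butler and McKay. The letters are
`1, …, 7, 0`, where `0` stands for the letter customarily called `8`. -/

namespace Octic

open Equiv

/-- 8T2, isomorphic to `C₄ × C₂` (regular, order 8). -/
def T2 : Subgroup (Perm (Fin 8)) := Subgroup.closure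
  {c[1, 2, 3, 0] * c[4, 5, 6, 7],
   c[1, 5] * c[2, 6] * c[3, 7] * c[4, 0]}

/-- 8T3, isomorphic to `C₂ × C₂ × C₂` (regular, order 8). -/
def T3 : Subgroup (Perm (Fin 8)) := Subgroup.closure
  {c[1, 0] * c[2, 3] * c[4, 5] * c[6, 7],
   c[1, 3] * c[2, 0] * c[4, 6] * c[5, 7],
   c[1, 5] * c[2, 6] * c[3, 7] * c[4, 0]}

/-- 8T4, isomorphic to the dihedral group of order 8 (regular). -/
def T4 : Subgroup (Perm (Fin 8)) := Subgroup.closure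
  {c[1, 2, 3, 0] * c[4, 5, 6, 7],
   c[1, 6] * c[2, 5] * c[3, 4] * c[7, 0]}

/-- 8T5, isomorphic to the quaternion group of order 8 (regular). -/
def T5 : Subgroup (Perm (Fin 8)) := Subgroup.closure
  {c[1, 2, 3, 0] * c[4, 5, 6, 7],
   c[1, 7, 3, 5] * c[2, 6, 0, 4]}

/-- 8T9, isomorphic to `D₄ × C₂` (order 16), where `D₄` is the dihedral group of order 8. -/
def T9 : Subgroup (Perm (Fin 8)) := Subgroup.closure
  {c[1, 0] * c[2, 3] * c[4, 5] * c[6, 7],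
   c[1, 3] * c[2, 0] * c[4, 6] * c[5, 7],
   c[1, 5] * c[2, 6] * c[3, 7] * c[4, 0],
   c[4, 5] * c[6, 7]}

/-- 8T11, isomorphic to the central product `C₄ ∘ D₄` (order 16). -/
def T11 : Subgroup (Perm (Fin 8)) := Subgroup.closure
  {c[1, 5] * c[3, 7],
   c[1, 3, 5, 7] * c[2, 4, 6, 0],
   c[1, 4, 5, 0] * c[2, 3, 6, 7]}

/-- 8T22, isomorphic to the extraspecial group `2₊¹⁺⁴`, the central product `D₄ ∘ D₄`
(order 32). -/
def T22 : Subgroup (Perm (Fin 8)) := Subgroup.closure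
  {c[1, 0] * c[2, 3] * c[4, 5] * c[6, 7],
   c[1, 3] * c[2, 0] * c[4, 6] * c[5, 7],
   c[1, 5] * c[2, 6] * c[3, 7] * c[4, 0],
   c[2, 3] * c[4, 5],
   c[2, 3] * c[6, 7]}

/-- The doubly even octic polynomial `x⁸ + a x⁴ + b`. -/
noncomputable def doublyEven (a b : ℚ) : ℚ[X] :=
  Polynomial.X ^ 8 + Polynomial.C a * Polynomial.X ^ 4 + Polynomial.C b

/-- `Occurs T`: the conjugacy class of `T` is that of the Galois group of some irreducible
polynomial `x⁸ + a x⁴ + b` over `ℚ` with `b` a rational square. -/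
def Occurs (T : Subgroup (Perm (Fin 8))) : Prop :=
  ∃ a b : ℚ, IsSquare b ∧ Irreducible (doublyEven a b) ∧ GalIs (doublyEven a b) T

end Octic

/-! Write `b = c²` and let `r` be a root. The values of `x⁴` at the roots are the two zeros of `y² +
ay + c²`, whose product is `c²`; hence the roots are `iᵏ r` and `iᵏ γ / r`, where `i² = -1` and `γ²
= c`. Both `i` and `γ` lie in the splitting field, so an automorphism is determined by `r ↦ iᵏ r` or
`iᵏ γ / r`, `i ↦ ±i`, `γ ↦ ±γ`. This gives 32 label permutations, and the Galois group is a
transitive group `G` of some of them.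

Transitivity forces the negation `r ↦ -r` into `G` (`Param.negation_mem`). Modulo negation the 32
permutations form `F₂⁴`, with coordinates `k mod 2, e, s, t`, so `G` is one of finitely many
subspaces, encoded by `Shape` (`exists_shape`). Complex conjugation adds one constraint: `G`
contains an element of square 1 that moves `i`. A finite computation (`Shape.conjTo_of_involution`)
takes every remaining shape to one of the six representatives. The quaternion group is excluded
because it has a single involution, while negation and conjugation are two.

For existence, each coordinate of `F₂⁴` is the character by which `G` acts on a square root of `2c -
a`, `a² - 4c²`, `-1` or `c`. A product of characters is trivial on `G` exactly when the
corresponding product of numbers is a rational square (`exists_numbering`), so these square classes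
determine `G` up to conjugacy. It remains to choose `a, c` with prescribed square relations; `a ≡ 3
mod 4` and `c` odd ensure irreducibility. -/

namespace Octic

open Equiv Polynomial

/-! ### Automorphisms as permutations of labels -/

/-- The data `(k, e, s, t)` of an automorphism `i ↦ (-1)ˢ i`, `γ ↦ (-1)ᵗ γ`, and `r ↦ iᵏ r` (for
`e = false`) or `r ↦ iᵏ γ / r` (for `e = true`). -/
abbrev Param : Type := Fin 4 × Bool × Bool × Bool

namespace Param

/-- The action of an automorphism on the labels of the roots, where `j < 4` is the label of `iʲ r`
and `4 + j` is the label of `iʲ γ / r`. -/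
def act (p : Param) (n : Fin 8) : Fin 8 :=
  let m := (if p.2.2.1 then 3 else 1) * n.val
  if n.val < 4 then
    ⟨(m + p.1.val) % 4 + 4 * p.2.1.toNat, by have := p.2.1.toNat_le; omega⟩
  else
    -- The term `3k` is `-k` modulo 4, since `r` is in the denominator. Using `n` for `n - 4` is
    -- harmless because `i⁴ = 1`.
    ⟨(m + 2 * p.2.2.2.toNat + 3 * p.1.val) % 4 + 4 * (!p.2.1).toNat, by
      have := (!p.2.1).toNat_le; omega⟩

/-- The data of the inverse automorphism. -/
def inverse (p : Param) : Param :=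
  (if p.2.1 then (if p.2.2.1 then 3 else 1) * (p.1 + if p.2.2.2 then 2 else 0)
    else (if p.2.2.1 then 1 else 3) * p.1, p.2)

/-- The permutation of the labels of the roots defined by an automorphism. -/
def toPerm (p : Param) : Perm (Fin 8) where
  toFun := p.act
  invFun := p.inverse.act
  left_inv := by revert p; unfold Function.LeftInverse; decide +kernel
  right_inv := by revert p; unfold Function.RightInverse Function.LeftInverse; decide +kernel

end Param

/-! ### Shapes of transitive groups and the finite classification -/

/-- The data of a transitive group of permutations of the form `Param.toPerm p`: the signs `s`
and `t` of an element with `(k, e) = (1, 0)` and of an element with `(k, e) = (0, 1)`, and which of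
the signs `(1, 0)`, `(0, 1)`, `(1, 1)` belong to the stabilizer of the label `0`. -/
abbrev Shape : Type := (Bool × Bool) × (Bool × Bool) × Bool × Bool × Bool

namespace Shape

/-- The stabilizer is closed under products. -/
def Valid (S : Shape) : Prop :=
  match S.2.2 with
  | (h₁, h₂, h₃) => (h₁ && h₂ → h₃) ∧ (h₁ && h₃ → h₂) ∧ (h₂ && h₃ → h₁)

instance (S : Shape) : Decidable S.Valid := by unfold Valid; infer_instance

/-- Whether signs belong to the stabilizer. -/
def stab (S : Shape) : Bool → Bool → Bool
  | false, false => true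
  | true, false => S.2.2.1
  | false, true => S.2.2.2.1
  | true, true => S.2.2.2.2

/-- Whether an element belongs to the group. -/
def mem (S : Shape) (p : Param) : Bool :=
  let k := p.1.val % 2 == 1
  S.stab (p.2.2.1 ^^ (k && S.1.1) ^^ (p.2.1 && S.2.1.1))
    (p.2.2.2 ^^ (k && S.1.2) ^^ (p.2.1 && S.2.1.2))

end Shape

/-- A permutation of eight labels given by its values and those of its inverse. -/
def permOfVals (v : Fin 8 → Fin 8) (h : Function.Bijective v) : Perm (Fin 8) where
  toFun := v
  -- The default 0 is never used, because `v` is surjective.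
  invFun n := ((List.finRange 8).find? (v · = n)).getD 0
  left_inv n := by
    change ((List.finRange 8).find? (v · = v n)).getD 0 = n
    cases hm : (List.finRange 8).find? (v · = v n) with
    | none => exact absurd (List.find?_eq_none.mp hm n (List.mem_finRange n)) (by simp)
    | some m => exact h.1 (by simpa using List.find?_some hm)
  right_inv n := by
    obtain ⟨m, rfl⟩ := h.2 n
    change v (((List.finRange 8).find? (v · = v m)).getD 0) = v m
    cases hm : (List.finRange 8).find? (v · = v m) with
    | none => exact absurd (List.find?_eq_none.mp hm m (List.mem_finRange m)) (by simp)
    | some m => simpa using List.find?_some hm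

/-- Renumberings that carry every shape to one of the representatives. -/
def renumberings : List (Perm (Fin 8)) :=
  [permOfVals ![0, 1, 2, 3, 4, 5, 6, 7] (by decide +kernel),
   permOfVals ![0, 1, 2, 3, 4, 7, 6, 5] (by decide +kernel),
   permOfVals ![0, 2, 1, 3, 4, 6, 5, 7] (by decide +kernel),
   permOfVals ![0, 4, 2, 6, 1, 5, 3, 7] (by decide +kernel),
   permOfVals ![0, 4, 2, 6, 1, 7, 3, 5] (by decide +kernel),
   permOfVals ![0, 1, 2, 3, 5, 4, 7, 6] (by decide +kernel),
   permOfVals ![0, 1, 2, 3, 5, 6, 7, 4] (by decide +kernel),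
   permOfVals ![0, 1, 4, 5, 2, 3, 6, 7] (by decide +kernel),
   permOfVals ![0, 1, 4, 5, 2, 7, 6, 3] (by decide +kernel),
   permOfVals ![0, 1, 4, 5, 3, 2, 7, 6] (by decide +kernel),
   permOfVals ![0, 1, 4, 5, 3, 6, 7, 2] (by decide +kernel),
   permOfVals ![0, 2, 1, 3, 4, 7, 5, 6] (by decide +kernel),
   permOfVals ![0, 2, 4, 6, 1, 3, 5, 7] (by decide +kernel),
   permOfVals ![0, 2, 4, 6, 1, 7, 5, 3] (by decide +kernel),
   permOfVals ![0, 4, 1, 5, 2, 6, 3, 7] (by decide +kernel),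
   permOfVals ![0, 4, 1, 5, 2, 7, 3, 6] (by decide +kernel),
   permOfVals ![0, 4, 1, 5, 6, 2, 7, 3] (by decide +kernel),
   permOfVals ![0, 4, 1, 5, 6, 3, 7, 2] (by decide +kernel),
   permOfVals ![0, 4, 2, 6, 5, 1, 7, 3] (by decide +kernel),
   permOfVals ![0, 4, 2, 6, 5, 3, 7, 1] (by decide +kernel)]

/-- The products `g₁ ^ i₁ * g₂ ^ i₂ * ⋯` with `iₗ < nₗ`, for a list of pairs `(gₗ, nₗ)`. -/
def normalForms : List (Perm (Fin 8) × ℕ) → List (Perm (Fin 8))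
  | [] => [1]
  | x :: l => (List.range x.2).flatMap fun i => (normalForms l).map (x.1 ^ i * ·)

theorem mem_closure_of_mem_normalForms {l : List (Perm (Fin 8) × ℕ)} {s : Set (Perm (Fin 8))}
    (hs : ∀ x ∈ l, x.1 ∈ s) {g : Perm (Fin 8)} (hg : g ∈ normalForms l) :
    g ∈ Subgroup.closure s := by
  induction l generalizing g with
  | nil => simp_all [normalForms, one_mem]
  | cons x l ih =>
    simp only [normalForms, List.mem_flatMap, List.mem_map] at hg
    obtain ⟨i, -, h, hh, rfl⟩ := hg
    exact mul_mem (pow_mem (Subgroup.subset_closure (hs x (by simp))) i)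
      (ih (fun y hy => hs y (by simp [hy])) hh)

/-- The permutation `π` conjugates the group of shape `S` to the group generated by the elements of
the list `l`, whose elements have the normal form given by `l`. -/
def Shape.ConjTo (S : Shape) (l : List (Perm (Fin 8) × ℕ)) (π : Perm (Fin 8)) : Prop :=
  (∀ x ∈ l, ∃ p : Param, S.mem p ∧ π * p.toPerm = x.1 * π) ∧
    ∀ p : Param, S.mem p → ∃ g ∈ normalForms l, π * p.toPerm = g * π

instance (S : Shape) (l : List (Perm (Fin 8) × ℕ)) (π : Perm (Fin 8)) :
    Decidable (S.ConjTo l π) := by unfold Shape.ConjTo; infer_instance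

/-- Generators of `T2`. -/
def gens2 : List (Perm (Fin 8) × ℕ) :=
  [(c[1, 2, 3, 0] * c[4, 5, 6, 7], 4), (c[1, 5] * c[2, 6] * c[3, 7] * c[4, 0], 2)]

/-- Generators of `T3`. -/
def gens3 : List (Perm (Fin 8) × ℕ) :=
  [(c[1, 0] * c[2, 3] * c[4, 5] * c[6, 7], 2), (c[1, 3] * c[2, 0] * c[4, 6] * c[5, 7], 2),
   (c[1, 5] * c[2, 6] * c[3, 7] * c[4, 0], 2)]

/-- Generators of `T4`. -/
def gens4 : List (Perm (Fin 8) × ℕ) :=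
  [(c[1, 2, 3, 0] * c[4, 5, 6, 7], 4), (c[1, 6] * c[2, 5] * c[3, 4] * c[7, 0], 2)]

/-- Generators of `T5`. -/
def gens5 : List (Perm (Fin 8) × ℕ) :=
  [(c[1, 2, 3, 0] * c[4, 5, 6, 7], 4), (c[1, 7, 3, 5] * c[2, 6, 0, 4], 2)]

/-- Generators of `T9`. -/
def gens9 : List (Perm (Fin 8) × ℕ) := gens3 ++ [(c[4, 5] * c[6, 7], 2)]

/-- Generators of `T11`. -/
def gens11 : List (Perm (Fin 8) × ℕ) :=
  [(c[1, 5] * c[3, 7], 2), (c[1, 3, 5, 7] * c[2, 4, 6, 0], 4),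
   (c[1, 4, 5, 0] * c[2, 3, 6, 7], 2)]

/-- Generators of `T22`. -/
def gens22 : List (Perm (Fin 8) × ℕ) :=
  gens3 ++ [(c[2, 3] * c[4, 5], 2), (c[2, 3] * c[6, 7], 2)]

/-- Exhaustive check over all shapes. The hypothesis is what complex conjugation supplies; it rules
out the quaternion group. -/
theorem Shape.conjTo_of_involution (S : Shape) (hS : S.Valid)
    (h : ∃ p : Param, S.mem p ∧ p.2.2.1 ∧ p.toPerm * p.toPerm = 1) :
    ∃ π ∈ renumberings, S.ConjTo gens2 π ∨ S.ConjTo gens3 π ∨ S.ConjTo gens4 π ∨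
      S.ConjTo gens9 π ∨ S.ConjTo gens11 π ∨ S.ConjTo gens22 π := by
  revert S
  decide +kernel

theorem Param.toPerm_stab_mul (s t s' t' : Bool) :
    toPerm (0, false, s, t) * toPerm (0, false, s', t') = toPerm (0, false, s ^^ s', t ^^ t') := by
  revert s t s' t'
  decide +kernel

/-- An element with `r ↦ -r` is negation if it fixes `i` and `γ`. If it moves `i`, its commutator
with `r ↦ i r` is negation; if it moves only `γ`, its commutator with `r ↦ γ / r` is. -/
theorem Param.negation_mem (s₁ t₁ s₂ t₂ s₃ t₃ : Bool) :
    toPerm (2, false, false, false) = toPerm (2, false, s₃, t₃) ∨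
    toPerm (2, false, false, false) = toPerm (2, false, s₃, t₃) * toPerm (1, false, s₁, t₁) *
      (toPerm (2, false, s₃, t₃))⁻¹ * (toPerm (1, false, s₁, t₁))⁻¹ ∨
    toPerm (2, false, false, false) = toPerm (2, false, s₃, t₃) * toPerm (0, true, s₂, t₂) *
      (toPerm (2, false, s₃, t₃))⁻¹ * (toPerm (0, true, s₂, t₂))⁻¹ := by
  revert s₁ t₁ s₂ t₂ s₃ t₃
  decide +kernel

/-- Normal form: a power of negation, a stabilizer element, then powers of the two chosen
representatives. When the other factors lie in the group, membership reduces to the stabilizer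
factor, which is how `Shape.mem` is defined. -/
theorem Param.toPerm_eq_mul (s₁ t₁ s₂ t₂ : Bool) (p : Param) :
    ∃ a : Fin 2, toPerm p = toPerm (2, false, false, false) ^ a.val *
      toPerm (0, false, p.2.2.1 ^^ (p.1.val % 2 == 1 && s₁) ^^ (p.2.1 && s₂),
        p.2.2.2 ^^ (p.1.val % 2 == 1 && t₁) ^^ (p.2.1 && t₂)) *
      toPerm (1, false, s₁, t₁) ^ (p.1.val % 2) * toPerm (0, true, s₂, t₂) ^ p.2.1.toNat := by
  revert s₁ t₁ s₂ t₂ p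
  decide +kernel

theorem Param.eq_of_toPerm_zero (p : Param) : p.1.val = (p.toPerm 0).val % 4 ∧
    p.2.1 = decide (4 ≤ (p.toPerm 0).val) := by
  revert p
  decide +kernel

theorem exists_shape (G : Subgroup (Perm (Fin 8))) (hG : ∀ g ∈ G, ∃ p : Param, g = p.toPerm)
    (ht : ∀ n, ∃ g ∈ G, g 0 = n) :
    ∃ S : Shape, S.Valid ∧ ∀ p : Param, S.mem p ↔ p.toPerm ∈ G := by
  classical
  have key (k : Fin 4) (e : Bool) : ∃ s t, Param.toPerm (k, e, s, t) ∈ G := by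
    obtain ⟨g, hg, hgn⟩ := ht ⟨k.val + 4 * e.toNat, by have := e.toNat_le; omega⟩
    obtain ⟨⟨k', e', s, t⟩, rfl⟩ := hG g hg
    obtain ⟨h₁, h₂⟩ := Param.eq_of_toPerm_zero (k', e', s, t)
    rw [hgn] at h₁ h₂
    have hk : k' = k := by
      ext
      dsimp only at h₁
      omega
    have he : e' = e := by
      have := k.isLt
      dsimp only at h₂
      rw [h₂]
      cases e
      · exact decide_eq_false (by simp)
      · exact decide_eq_true (by simp)
    exact ⟨s, t, hk ▸ he ▸ hg⟩
  obtain ⟨s₁, t₁, hA⟩ := key 1 false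
  obtain ⟨s₂, t₂, hB⟩ := key 0 true
  obtain ⟨s₃, t₃, hD⟩ := key 2 false
  have hcomm {x y : Perm (Fin 8)} (hx : x ∈ G) (hy : y ∈ G) : x * y * x⁻¹ * y⁻¹ ∈ G :=
    mul_mem (mul_mem (mul_mem hx hy) (inv_mem hx)) (inv_mem hy)
  have hz : Param.toPerm (2, false, false, false) ∈ G := by
    rcases Param.negation_mem s₁ t₁ s₂ t₂ s₃ t₃ with h | h | h <;> rw [h]
    exacts [hD, hcomm hD hA, hcomm hD hB]
  have h₀ : Param.toPerm (0, false, false, false) ∈ G := by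
    have : Param.toPerm (0, false, false, false) = 1 := by decide +kernel
    exact this ▸ one_mem G
  obtain ⟨c, hc⟩ : ∃ c : Bool → Bool → Bool,
      ∀ s t, c s t ↔ Param.toPerm (0, false, s, t) ∈ G :=
    ⟨fun s t => decide (Param.toPerm (0, false, s, t) ∈ G), fun s t => decide_eq_true_iff⟩
  have hmul (s t s' t' : Bool) (h : c s t) (h' : c s' t') : c (s ^^ s') (t ^^ t') := by
    rw [hc] at h h' ⊢
    exact Param.toPerm_stab_mul s t s' t' ▸ mul_mem h h'
  rw [← hc] at h₀
  refine ⟨((s₁, t₁), (s₂, t₂), c true false, c false true, c true true), ?_, fun p => ?_⟩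
  · simp only [Shape.Valid, Bool.and_eq_true]
    exact ⟨fun h => hmul _ _ _ _ h.1 h.2, fun h => hmul _ _ _ _ h.1 h.2,
      fun h => hmul _ _ _ _ h.1 h.2⟩
  · obtain ⟨a, ha⟩ := Param.toPerm_eq_mul s₁ t₁ s₂ t₂ p
    have hstab (s t : Bool) :
        Shape.stab ((s₁, t₁), (s₂, t₂), c true false, c false true, c true true) s t = c s t := by
      cases s <;> cases t
      exacts [h₀.symm, rfl, rfl, rfl]
    rw [Shape.mem, hstab, hc, ha, Subgroup.mul_mem_cancel_right _ (pow_mem hB _),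
      Subgroup.mul_mem_cancel_right _ (pow_mem hA _),
      Subgroup.mul_mem_cancel_left _ (pow_mem hz _)]

/-! ### Quadratic characters and the shapes they determine -/

/-- The value on an element of the quadratic character which is the product of the basic characters
`(-1)ᵏ`, `(-1)ᵉ`, `(-1)ˢ` and `(-1)ᵗ` selected by `χ`; the value `true` stands for `-1`. -/
def Param.sign (χ : Bool × Bool × Bool × Bool) (p : Param) : Bool :=
  (χ.1 && p.1.val % 2 == 1) ^^ (χ.2.1 && p.2.1) ^^ (χ.2.2.1 && p.2.2.1) ^^ (χ.2.2.2 && p.2.2.2)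

/-- The characters that are trivial on a group of the given shape are those in the list `R`. -/
def Shape.HasRelations (S : Shape) (R : List (Bool × Bool × Bool × Bool)) : Prop :=
  ∀ χ, (∀ p : Param, S.mem p → p.sign χ = false) ↔ χ ∈ R

instance (S : Shape) (R) : Decidable (S.HasRelations R) := by
  unfold Shape.HasRelations; infer_instance

/-- The group contains negation, and its image in `F₂⁴` is the annihilator of the list of trivial
characters. The list therefore fixes the group, and a finite check identifies its class; likewise
for the next five lists. -/
theorem Shape.conjTo_gens2 (S : Shape) (hS : S.Valid) (h : S.HasRelations
    [(false, false, false, false), (false, true, false, true), (true, false, true, true),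
      (true, true, true, false)]) : ∃ π ∈ renumberings, S.ConjTo gens2 π := by
  revert S
  decide +kernel

theorem Shape.conjTo_gens3 (S : Shape) (hS : S.Valid) (h : S.HasRelations
    [(false, false, false, false), (false, false, false, true), (true, true, true, false),
      (true, true, true, true)]) : ∃ π ∈ renumberings, S.ConjTo gens3 π := by
  revert S
  decide +kernel

theorem Shape.conjTo_gens4 (S : Shape) (hS : S.Valid) (h : S.HasRelations
    [(false, false, false, false), (false, false, false, true), (true, false, true, false),
      (true, false, true, true)]) : ∃ π ∈ renumberings, S.ConjTo gens4 π := by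
  revert S
  decide +kernel

theorem Shape.conjTo_gens9 (S : Shape) (hS : S.Valid) (h : S.HasRelations
    [(false, false, false, false), (false, false, false, true)]) :
    ∃ π ∈ renumberings, S.ConjTo gens9 π := by
  revert S
  decide +kernel

theorem Shape.conjTo_gens11 (S : Shape) (hS : S.Valid) (h : S.HasRelations
    [(false, false, false, false), (true, true, false, true)]) :
    ∃ π ∈ renumberings, S.ConjTo gens11 π := by
  revert S
  decide +kernel

theorem Shape.conjTo_gens22 (S : Shape) (hS : S.Valid) (h : S.HasRelations
    [(false, false, false, false)]) : ∃ π ∈ renumberings, S.ConjTo gens22 π := by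
  revert S
  decide +kernel

theorem closure_gens2 : Subgroup.closure {g | ∃ x ∈ gens2, x.1 = g} = T2 := by
  congr 1; ext g; simp [gens2, eq_comm]

theorem closure_gens3 : Subgroup.closure {g | ∃ x ∈ gens3, x.1 = g} = T3 := by
  congr 1; ext g; simp [gens3, eq_comm]

theorem closure_gens4 : Subgroup.closure {g | ∃ x ∈ gens4, x.1 = g} = T4 := by
  congr 1; ext g; simp [gens4, eq_comm]

theorem closure_gens5 : Subgroup.closure {g | ∃ x ∈ gens5, x.1 = g} = T5 := by
  congr 1; ext g; simp [gens5, eq_comm]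

theorem closure_gens9 : Subgroup.closure {g | ∃ x ∈ gens9, x.1 = g} = T9 := by
  congr 1; ext g; simp [gens9, gens3, eq_comm]

theorem closure_gens11 : Subgroup.closure {g | ∃ x ∈ gens11, x.1 = g} = T11 := by
  congr 1; ext g; simp [gens11, eq_comm]

theorem closure_gens22 : Subgroup.closure {g | ∃ x ∈ gens22, x.1 = g} = T22 := by
  congr 1; ext g; simp [gens22, gens3, eq_comm]

/-- One inclusion holds because every conjugated element is a word in the generators, the other
because every generator is a conjugated element. The normal forms need not be shown closed under
products. -/
theorem Shape.ConjTo.map_conj_eq {S : Shape} {l : List (Perm (Fin 8) × ℕ)} {π : Perm (Fin 8)}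
    (h : S.ConjTo l π) {G : Subgroup (Perm (Fin 8))} (hG : ∀ g ∈ G, ∃ p : Param, g = p.toPerm)
    (hS : ∀ p : Param, S.mem p ↔ p.toPerm ∈ G) :
    G.map π.permCongrHom.toMonoidHom = Subgroup.closure {g | ∃ x ∈ l, x.1 = g} := by
  have hπ (g h : Perm (Fin 8)) (hgh : π * g = h * π) : π.permCongrHom.toMonoidHom g = h := by
    ext n
    have := congrArg (· (π.symm n)) hgh
    simp at this
    simp [this]
  apply le_antisymm
  · rintro _ ⟨g, hg, rfl⟩
    obtain ⟨p, rfl⟩ := hG g hg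
    obtain ⟨g', hg', hpg⟩ := h.2 p ((hS p).2 hg)
    rw [hπ _ _ hpg]
    have hl : ∀ x ∈ l, x.1 ∈ {g | ∃ x ∈ l, x.1 = g} := fun x hx => ⟨x, hx, rfl⟩
    exact mem_closure_of_mem_normalForms hl hg'
  · rw [Subgroup.closure_le]
    rintro _ ⟨x, hx, rfl⟩
    obtain ⟨p, hp, hpx⟩ := h.1 x hx
    exact ⟨p.toPerm, (hS p).1 hp, hπ _ _ hpx⟩

theorem eq_of_involution_of_mem_T5 {g : Perm (Fin 8)} (hg : g ∈ T5) (h₂ : g * g = 1)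
    -- The eight normal forms contain the generators and are closed under products and inverses, so
    -- they exhaust `T5`. The second generator needs only exponents 0 and 1, its square being the
    -- square of the first.
    (h₁ : g ≠ 1) : g = c[1, 3] * c[2, 0] * c[4, 6] * c[5, 7] := by
  have hmul : (normalForms gens5).all fun x => (normalForms gens5).all fun y =>
      decide (x * y ∈ normalForms gens5) := by
    decide +kernel
  have hinv : (normalForms gens5).all fun x => decide (x⁻¹ ∈ normalForms gens5) := by
    decide +kernel
  have hgen : ∀ x ∈ gens5, x.1 ∈ normalForms gens5 := by decide +kernel
  have hone : 1 ∈ normalForms gens5 := by decide +kernel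
  have key : (normalForms gens5).all fun g => decide (g * g = 1 → g ≠ 1 →
      g = c[1, 3] * c[2, 0] * c[4, 6] * c[5, 7]) := by
    decide +kernel
  simp only [List.all_eq_true, decide_eq_true_eq] at hmul hinv key
  refine key g ?_ h₂ h₁
  rw [← closure_gens5] at hg
  clear h₂ h₁
  induction hg using Subgroup.closure_induction with
  | mem x hx =>
    obtain ⟨y, hy, rfl⟩ := hx
    exact hgen y hy
  | one => exact hone
  | mul x y _ _ hx hy => exact hmul x hx y hy
  | inv x _ hx => exact hinv x hx

/-! ### Roots and Kummer generators in a field -/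

section Field

variable {K : Type*} [Field K]

/-- The roots of `x⁸ + a x⁴ + c²` in terms of a root `r`, a square root `i` of `-1` and a square
root `γ` of `c`. -/
def labelledRoot (r i γ : K) (n : Fin 8) : K :=
  i ^ n.val * if n.val < 4 then r else γ / r

/-- The ring endomorphism `σ` acts on `i`, `γ` and `r` as described by `p`. -/
structure Describes (p : Param) (σ : K →+* K) (r i γ : K) : Prop where
  map_i : σ i = i ^ (if p.2.2.1 then 3 else 1)
  map_gamma : σ γ = i ^ (2 * p.2.2.2.toNat) * γ
  map_r : σ r = i ^ p.1.val * bif p.2.1 then γ / r else r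

theorem Describes.map_labelledRoot {p : Param} {σ : K →+* K} {r i γ : K} (h : Describes p σ r i γ)
    (hi : i ^ 2 = -1) (hr : r ≠ 0) (hγ : γ ≠ 0) (n : Fin 8) :
    σ (labelledRoot r i γ n) = labelledRoot r i γ (p.toPerm n) := by
  have hi4 : i ^ 4 = 1 := by linear_combination (i ^ 2 - 1) * hi
  have hi0 : i ≠ 0 := by rintro rfl; simp at hi
  have hmod (m : ℕ) (e : Bool) : i ^ (m % 4 + 4 * e.toNat) = i ^ m := by
    rw [pow_add, pow_mul, hi4, one_pow, mul_one, ← pow_eq_pow_mod m hi4]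
  have hinv (m : ℕ) : i ^ (3 * m) * i ^ m = 1 := by
    rw [← pow_add, show 3 * m + m = 4 * m by ring, pow_mul, hi4, one_pow]
  have hlt (m : ℕ) (e : Bool) : m % 4 + 4 * e.toNat < 4 ↔ e = false := by
    have : m % 4 < 4 := Nat.mod_lt _ (by norm_num)
    cases e <;> simp [this]
  change _ = labelledRoot r i γ (p.act n)
  unfold Param.act labelledRoot
  dsimp only
  by_cases hn : n.val < 4
  · simp only [hn, if_true, map_mul, map_pow, h.map_i, h.map_r, hlt, hmod]
    rw [pow_add, pow_mul]
    cases p.2.1 <;> simp [mul_assoc]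
  · simp only [hn, if_false, map_mul, map_pow, map_div₀, h.map_i, h.map_r, h.map_gamma, hlt, hmod]
    rw [pow_add, pow_add, pow_mul]
    have := hinv p.1.val
    have hk : i ^ p.1.val ≠ 0 := pow_ne_zero _ hi0
    cases p.2.1
    · simp only [cond_false, Bool.not_false, Bool.true_eq_false, if_false]
      field_simp
      linear_combination (-(i ^ (if p.2.2.1 then 3 else 1)) ^ n.val) * this
    · simp only [cond_true, Bool.not_true, if_true]
      field_simp
      linear_combination (-(i ^ (if p.2.2.1 then 3 else 1)) ^ n.val) * this

theorem eq_labelledRoot {a c r i γ x : K} (hi : i ^ 2 = -1) (hγ : γ ^ 2 = c) (hr : r ≠ 0)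
    (hr' : r ^ 8 + a * r ^ 4 + c ^ 2 = 0) (hx : x ^ 8 + a * x ^ 4 + c ^ 2 = 0) :
    ∃ (k : Fin 4) (e : Bool), x = i ^ k.val * bif e then γ / r else r := by
  have aux (y : K) (h : x ^ 4 = y ^ 4) : ∃ k : Fin 4, x = i ^ k.val * y := by
    have : (x - i ^ 0 * y) * (x - i ^ 1 * y) * (x - i ^ 2 * y) * (x - i ^ 3 * y) = 0 := by
      linear_combination h + (-i * x ^ 3 * y - x ^ 3 * y + i ^ 3 * x ^ 2 * y ^ 2 +
        i ^ 2 * x ^ 2 * y ^ 2 + i * x ^ 2 * y ^ 2 - i ^ 4 * x * y ^ 3 - i ^ 3 * x * y ^ 3 +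
        i ^ 4 * y ^ 4 - i ^ 2 * y ^ 4 + y ^ 4) * hi
    simp only [mul_eq_zero, sub_eq_zero, or_assoc] at this
    rcases this with h | h | h | h
    exacts [⟨0, h⟩, ⟨1, h⟩, ⟨2, h⟩, ⟨3, h⟩]
  -- Vieta: `r⁴` and `c² / r⁴ = (γ / r)⁴` are the two zeros of `y² + ay + c²`.
  have : (x ^ 4 - r ^ 4) * (x ^ 4 - (γ / r) ^ 4) = 0 := by
    have h4 : (γ / r) ^ 4 = c ^ 2 / r ^ 4 := by rw [div_pow, ← hγ]; ring
    rw [h4]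
    field_simp
    linear_combination r ^ 4 * hx - x ^ 4 * hr'
  rcases mul_eq_zero.mp this with h | h
  · obtain ⟨k, hk⟩ := aux r (sub_eq_zero.mp h)
    exact ⟨k, false, hk⟩
  · obtain ⟨k, hk⟩ := aux _ (sub_eq_zero.mp h)
    exact ⟨k, true, hk⟩

/-- The field element on which automorphisms act through the character `χ`, as a
product of the elements that are multiplied by the four basic characters. -/
def kummerGenerator (c r i γ : K) (χ : Bool × Bool × Bool × Bool) : K :=
  (bif χ.1 then r ^ 2 + c / r ^ 2 else 1) * (bif χ.2.1 then r ^ 4 - c ^ 2 / r ^ 4 else 1) *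
    (bif χ.2.2.1 then i else 1) * bif χ.2.2.2 then γ else 1

theorem Describes.map_kummerGenerator {p : Param} {σ : K →+* K} {c r i γ : K}
    (h : Describes p σ r i γ) (hi : i ^ 2 = -1) (hγ : γ ^ 2 = c) (hr : r ≠ 0) (hc : c ≠ 0)
    (hσ : σ c = c) (χ : Bool × Bool × Bool × Bool) :
    σ (kummerGenerator c r i γ χ) =
      (bif p.sign χ then -1 else 1) * kummerGenerator c r i γ χ := by
  have hγ0 : γ ≠ 0 := by rintro rfl; exact hc (by rw [← hγ]; ring)
  have hxor (b b' : Bool) : (bif b ^^ b' then (-1 : K) else 1) =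
      (bif b then -1 else 1) * bif b' then -1 else 1 := by cases b <;> cases b' <;> simp
  have hand {x : K} {b : Bool} (hx : σ x = (bif b then -1 else 1) * x) (b' : Bool) :
      σ (bif b' then x else 1) = (bif b' && b then -1 else 1) * bif b' then x else 1 := by
    cases b' <;> simp [hx]
  have hk2 : (i ^ p.1.val) ^ 2 = bif p.1.val % 2 == 1 then -1 else 1 := by
    rw [← pow_mul, mul_comm, pow_mul, hi]
    rcases Nat.mod_two_eq_zero_or_one p.1.val with h | h <;>
      simp [h, neg_one_pow_eq_pow_mod_two]
  have hk4 : ((i ^ p.1.val) ^ 2) ^ 2 = 1 := by rw [hk2]; cases p.1.val % 2 == 1 <;> simp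
  have h₁ : σ (r ^ 2 + c / r ^ 2) =
      (bif p.1.val % 2 == 1 then -1 else 1) * (r ^ 2 + c / r ^ 2) := by
    rw [← hk2, map_add, map_div₀, map_pow, hσ, h.map_r]
    have hk0 : (i ^ p.1.val) ≠ 0 := by intro h; simp [h] at hk4
    generalize i ^ p.1.val = u at *
    cases p.2.1
    · simp only [cond_false]
      field_simp
      linear_combination (-c) * hk4
    · simp only [cond_true]
      subst hγ
      field_simp
      linear_combination (-r ^ 4) * hk4
  have h₂ : σ (r ^ 4 - c ^ 2 / r ^ 4) = (bif p.2.1 then -1 else 1) * (r ^ 4 - c ^ 2 / r ^ 4) := by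
    have hu : (i ^ p.1.val) ^ 4 = 1 := by rw [← hk4]; ring
    rw [map_sub, map_div₀, map_pow, map_pow, hσ, h.map_r]
    cases p.2.1
    · simp only [cond_false, mul_pow, hu, one_mul]
    · simp only [cond_true, mul_pow, hu, one_mul]
      subst hγ
      field_simp
      ring
  have h₃ : σ i = (bif p.2.2.1 then -1 else 1) * i := by
    rw [h.map_i]
    cases p.2.2.1
    · simp
    · simp only [if_true, cond_true]
      linear_combination i * hi
  have h₄ : σ γ = (bif p.2.2.2 then -1 else 1) * γ := by
    rw [h.map_gamma]
    cases p.2.2.2 <;> simp [hi]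
  simp only [kummerGenerator, Param.sign, map_mul, hxor, hand h₁, hand h₂, hand h₃, hand h₄]
  ring

/-- The rational number of which `kummerGenerator` is a square root. -/
def kummerSquare (a c : K) (χ : Bool × Bool × Bool × Bool) : K :=
  (bif χ.1 then 2 * c - a else 1) * (bif χ.2.1 then a ^ 2 - 4 * c ^ 2 else 1) *
    (bif χ.2.2.1 then -1 else 1) * bif χ.2.2.2 then c else 1

theorem map_kummerSquare {L : Type*} [Field L] (φ : K →+* L) (a c : K)
    (χ : Bool × Bool × Bool × Bool) :
    φ (kummerSquare a c χ) = kummerSquare (φ a) (φ c) χ := by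
  have hcond (b : Bool) (x : K) : φ (bif b then x else 1) = bif b then φ x else 1 := by
    cases b <;> simp
  simp only [kummerSquare, map_mul, hcond, map_sub, map_pow, map_neg, map_one, map_ofNat]

theorem kummerSquare_ne_zero {a c : K} (h₁ : 2 * c - a ≠ 0) (h₂ : a ^ 2 - 4 * c ^ 2 ≠ 0)
    (hc : c ≠ 0) (χ : Bool × Bool × Bool × Bool) : kummerSquare a c χ ≠ 0 := by
  have hcond (b : Bool) {x : K} (hx : x ≠ 0) : (bif b then x else 1) ≠ 0 := by
    cases b <;> simp [hx]
  exact mul_ne_zero (mul_ne_zero (mul_ne_zero (hcond _ h₁) (hcond _ h₂))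
    (hcond _ (neg_ne_zero.2 one_ne_zero))) (hcond _ hc)

theorem kummerGenerator_sq {a c r i γ : K} (hi : i ^ 2 = -1) (hγ : γ ^ 2 = c) (hr : r ≠ 0)
    (hr' : r ^ 8 + a * r ^ 4 + c ^ 2 = 0) (χ : Bool × Bool × Bool × Bool) :
    kummerGenerator c r i γ χ ^ 2 = kummerSquare a c χ := by
  have hcond {x y : K} (h : x ^ 2 = y) (b : Bool) :
      (bif b then x else 1) ^ 2 = bif b then y else 1 := by cases b <;> simp [h]
  have h₁ : (r ^ 2 + c / r ^ 2) ^ 2 = 2 * c - a := by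
    field_simp
    linear_combination hr'
  have h₂ : (r ^ 4 - c ^ 2 / r ^ 4) ^ 2 = a ^ 2 - 4 * c ^ 2 := by
    field_simp
    linear_combination (r ^ 8 - a * r ^ 4 + c ^ 2) * hr'
  simp only [kummerGenerator, kummerSquare, mul_pow, hcond h₁, hcond h₂, hcond hi, hcond hγ]

end Field

/-! ### The Galois action in the labelled numbering -/

section Numbering

variable {F : Type*} [Field F]

theorem natDegree_octic {R : Type*} [CommRing R] [Nontrivial R] (a b : R) :
    (X ^ 8 + C a * X ^ 4 + C b).natDegree = 8 := by
  compute_degree!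

theorem mem_rootSet_octic {K : Type*} [Field K] [Algebra F K] {a b : F} {x : K} :
    x ∈ (X ^ 8 + C a * X ^ 4 + C b).rootSet K ↔
      x ^ 8 + algebraMap F K a * x ^ 4 + algebraMap F K b = 0 := by
  have h0 : X ^ 8 + C a * X ^ 4 + C b ≠ 0 := ne_zero_of_natDegree_gt (n := 0) (by
    rw [natDegree_octic]; norm_num)
  rw [mem_rootSet_of_ne h0]
  simp

theorem ne_zero_of_irreducible {a b : F} (hf : Irreducible (X ^ 8 + C a * X ^ 4 + C b)) :
    b ≠ 0 := by
  rintro rfl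
  refine hf.not_isRoot_of_natDegree_ne_one (x := 0) ?_ ?_
  · rw [natDegree_octic]; norm_num
  · simp

theorem exists_algebraMap_eq {E : Type*} [Field E] [Algebra F E] {f : F[X]}
    [Fact ((f.map (algebraMap F E)).Splits)] {z : E} (hz : z ∈ f.rootSet E) :
    ∃ x : f.SplittingField, algebraMap f.SplittingField E x = z :=
  ⟨(Gal.rootsEquivRoots f E).symm ⟨z, hz⟩,
    congrArg Subtype.val ((Gal.rootsEquivRoots f E).apply_symm_apply ⟨z, hz⟩)⟩

theorem exists_describes [CharZero F] (E : Type*) [Field E] [Algebra F E] [IsAlgClosed E] {a c : F}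
    {f : F[X]} (hfdef : f = X ^ 8 + C a * X ^ 4 + C (c * c)) (hf : Irreducible f)
    [Fact ((f.map (algebraMap F E)).Splits)] :
    ∃ (r i γ : f.SplittingField) (e : f.rootSet E ≃ Fin 8),
      r ≠ 0 ∧ r ^ 8 + algebraMap F _ a * r ^ 4 + (algebraMap F _ c) ^ 2 = 0 ∧ i ^ 2 = -1 ∧
      γ ^ 2 = algebraMap F _ c ∧
      ∀ σ : f.Gal, ∃ p : Param, Describes p (σ : f.SplittingField →+* f.SplittingField) r i γ ∧
        e.permCongrHom.toMonoidHom (Gal.galActionHom f E σ) = p.toPerm := by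
  have hc : c ≠ 0 := by rintro rfl; exact ne_zero_of_irreducible (hfdef ▸ hf) (by simp)
  have hroot {L : Type _} [Field L] [Algebra F L] {x : L} : x ∈ f.rootSet L ↔
      x ^ 8 + algebraMap F L a * x ^ 4 + (algebraMap F L c) ^ 2 = 0 := by
    rw [hfdef, mem_rootSet_octic, map_mul, sq]
  have hrootE {x : E} : x ∈ f.rootSet E ↔
      x ^ 8 + algebraMap F E a * x ^ 4 + (algebraMap F E c) ^ 2 = 0 := by
    rw [hfdef, mem_rootSet_octic, map_mul, sq]
  have hcard : Fintype.card (f.rootSet f.SplittingField) = 8 := by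
    rw [card_rootSet_eq_natDegree hf.separable (SplittingField.splits f), hfdef, natDegree_octic]
  have hinj : Function.Injective (algebraMap f.SplittingField E) := RingHom.injective _
  have htower (q : F) : algebraMap f.SplittingField E (algebraMap F _ q) = algebraMap F E q :=
    (IsScalarTower.algebraMap_apply F f.SplittingField E q).symm
  obtain ⟨r, hr⟩ : (f.rootSet f.SplittingField).Nonempty := by
    rw [← Set.nonempty_coe_sort, ← Fintype.card_pos_iff, hcard]
    norm_num
  have hr' := hroot.1 hr
  have hc' : algebraMap F f.SplittingField c ≠ 0 := by simpa using hc
  have hr0 : r ≠ 0 := by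
    rintro rfl
    simp at hr'
    exact hc hr'
  have hz := congrArg (algebraMap f.SplittingField E) hr'
  simp only [map_add, map_mul, map_pow, htower, map_zero] at hz
  have hz0 : algebraMap f.SplittingField E r ≠ 0 := by simpa using hr0
  -- With `j² = -1` in `E`, `j r` is again a root, so it comes from the splitting field; so does `j
  -- = (j r) / r`.
  obtain ⟨i, hi⟩ : ∃ i : f.SplittingField, i ^ 2 = -1 := by
    obtain ⟨j, hj⟩ := IsAlgClosed.exists_pow_nat_eq (-1 : E) two_pos
    obtain ⟨x, hx⟩ := exists_algebraMap_eq (f := f)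
      (z := j * algebraMap f.SplittingField E r) (hrootE.2 (by
        linear_combination hz + (algebraMap f.SplittingField E r ^ 8 *
          (j ^ 6 - j ^ 4 + j ^ 2 - 1) + algebraMap F E a *
            algebraMap f.SplittingField E r ^ 4 * (j ^ 2 - 1)) * hj))
    refine ⟨x / r, hinj ?_⟩
    rw [map_pow, map_div₀, hx, mul_div_assoc, div_self hz0, mul_one, hj]
    simp
  -- Similarly a square root `g` of `c` is the product of the roots `g / r` and `r`.
  obtain ⟨γ, hγ⟩ : ∃ γ : f.SplittingField, γ ^ 2 = algebraMap F _ c := by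
    obtain ⟨g, hg⟩ := IsAlgClosed.exists_pow_nat_eq (algebraMap F E c) two_pos
    obtain ⟨x, hx⟩ := exists_algebraMap_eq (f := f)
      (z := g / algebraMap f.SplittingField E r) (hrootE.2 (by
        rw [← hg] at hz ⊢
        field_simp
        linear_combination g ^ 4 * hz))
    refine ⟨x * r, hinj ?_⟩
    rw [map_pow, map_mul, hx, div_mul_cancel₀ _ hz0, hg, htower]
  have hγ0 : γ ≠ 0 := by rintro rfl; exact hc' (by rw [← hγ]; ring)
  have hmem (n : Fin 8) : labelledRoot r i γ n ∈ f.rootSet f.SplittingField := by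
    have hi4 : (i ^ n.val) ^ 4 = 1 := by
      rw [← pow_mul, mul_comm, pow_mul, show i ^ 4 = 1 by linear_combination (i ^ 2 - 1) * hi,
        one_pow]
    rw [hroot, labelledRoot]
    generalize i ^ n.val = u at hi4
    split_ifs
    · linear_combination hr' + (r ^ 8 * (u ^ 4 + 1) + algebraMap F _ a * r ^ 4) * hi4
    · rw [← hγ] at hr' ⊢
      field_simp
      linear_combination γ ^ 4 * hr' +
        (γ ^ 8 * (u ^ 4 + 1) + algebraMap F _ a * r ^ 4 * γ ^ 4) * hi4
  have hexp {x : f.SplittingField} (hx : x ∈ f.rootSet f.SplittingField) :=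
    eq_labelledRoot hi hγ hr0 hr' (hroot.1 hx)
  let R (n : Fin 8) : f.rootSet f.SplittingField := ⟨labelledRoot r i γ n, hmem n⟩
  have hR : Function.Bijective R := by
    rw [Fintype.bijective_iff_surjective_and_card, hcard,
      Fintype.card_fin]
    refine ⟨fun x => ?_, rfl⟩
    obtain ⟨k, e, hke⟩ := hexp x.2
    refine ⟨⟨k.val + 4 * e.toNat, by have := e.toNat_le; omega⟩, Subtype.ext ?_⟩
    simp only [R, labelledRoot, hke]
    have hi4 : i ^ 4 = 1 := by linear_combination (i ^ 2 - 1) * hi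
    cases e <;> simp [pow_add, hi4]
  let e : f.rootSet E ≃ Fin 8 := (Gal.rootsEquivRoots f E).symm.trans (Equiv.ofBijective R hR).symm
  refine ⟨r, i, γ, e, hr0, hr', hi, hγ, fun σ => ?_⟩
  have hσr : σ r ∈ f.rootSet f.SplittingField := rootSet_mapsTo σ.toAlgHom hr
  obtain ⟨k, b, hkb⟩ := hexp hσr
  obtain ⟨s, hs⟩ : ∃ s : Bool, σ i = i ^ (if s then 3 else 1) := by
    have : (σ i - i) * (σ i + i) = 0 := by
      have := congrArg σ hi
      simp only [map_pow, map_neg, map_one] at this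
      linear_combination this - hi
    rcases mul_eq_zero.mp this with h | h
    · exact ⟨false, by simpa [sub_eq_zero] using h⟩
    · exact ⟨true, by simp only [if_true]; linear_combination h - i * hi⟩
  obtain ⟨t, ht⟩ : ∃ t : Bool, σ γ = i ^ (2 * t.toNat) * γ := by
    have : (σ γ - γ) * (σ γ + γ) = 0 := by
      have := congrArg σ hγ
      have hσc : σ (algebraMap F _ c) = algebraMap F _ c := AlgEquiv.commutes σ c
      rw [map_pow, hσc, ← hγ] at this
      linear_combination this
    rcases mul_eq_zero.mp this with h | h
    · exact ⟨false, by simpa [sub_eq_zero] using h⟩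
    · exact ⟨true, by simp only [Bool.toNat_true, mul_one, hi]; linear_combination h⟩
  have hd : Describes (k, b, s, t) (σ : f.SplittingField →+* f.SplittingField) r i γ :=
    ⟨hs, ht, hkb⟩
  refine ⟨(k, b, s, t), hd, ?_⟩
  ext1 n
  change e (Gal.galActionHom f E σ (e.symm n)) = _
  rw [← Equiv.eq_symm_apply]
  change σ • (Gal.rootsEquivRoots f E (R n)) = Gal.rootsEquivRoots f E (R _)
  rw [Gal.smul_def, Equiv.symm_apply_apply]
  congr 1
  exact Subtype.ext (hd.map_labelledRoot hi hr0 hγ0 n)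

theorem Param.toPerm_injective : Function.Injective Param.toPerm := by
  have h : ∀ p q : Param, p.toPerm = q.toPerm → p = q := by decide +kernel
  exact fun p q => h p q

/-- The last clause is Kummer theory: every automorphism multiplies the generator `D` by the sign of
`χ`, so `χ` is trivial exactly when `D` is fixed, that is, when `D` lies in the base field and `D²`
is a square there. -/
theorem exists_numbering [CharZero F] (E : Type*) [Field E] [Algebra F E] [IsAlgClosed E] {a c : F}
    {f : F[X]} (hfdef : f = X ^ 8 + C a * X ^ 4 + C (c * c)) (hf : Irreducible f)
    [Fact ((f.map (algebraMap F E)).Splits)] :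
    ∃ e : f.rootSet E ≃ Fin 8,
      (∀ σ : f.Gal, ∃ p : Param,
        e.permCongrHom.toMonoidHom (Gal.galActionHom f E σ) = p.toPerm) ∧
      (∀ (τ : E ≃ₐ[F] E) (p : Param), (∀ j : E, j ^ 2 = -1 → τ j ≠ j) →
        e.permCongrHom.toMonoidHom (Gal.galActionHom f E (Gal.restrict f E τ)) = p.toPerm →
        p.2.2.1 = true) ∧
      (2 * c - a ≠ 0 → a ^ 2 - 4 * c ^ 2 ≠ 0 → ∀ χ,
        (∀ (σ : f.Gal) (p : Param),
          e.permCongrHom.toMonoidHom (Gal.galActionHom f E σ) = p.toPerm → p.sign χ = false) ↔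
        IsSquare (kummerSquare a c χ)) := by
  obtain ⟨r, i, γ, e, hr0, hr, hi, hγ, h⟩ := exists_describes E hfdef hf
  have hdesc (σ : f.Gal) (p : Param)
      (hp : e.permCongrHom.toMonoidHom (Gal.galActionHom f E σ) = p.toPerm) :
      Describes p (σ : f.SplittingField →+* f.SplittingField) r i γ := by
    obtain ⟨q, hq, hqp⟩ := h σ
    exact Param.toPerm_injective (hqp.symm.trans hp) ▸ hq
  refine ⟨e, fun σ => (h σ).imp fun p hp => hp.2, fun τ p hτ hp => ?_, fun h₁ h₂ χ => ?_⟩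
  · by_contra hs
    have hfix : Gal.restrict f E τ i = i := by
      have := (hdesc _ p hp).map_i
      simpa [hs] using this
    refine hτ (algebraMap f.SplittingField E i) (by rw [← map_pow, hi]; simp) ?_
    have := AlgEquiv.restrictNormal_commutes τ f.SplittingField i
    rw [← this]
    exact congrArg _ hfix
  · have hc : c ≠ 0 := by rintro rfl; exact ne_zero_of_irreducible (hfdef ▸ hf) (by simp)
    have hc' : algebraMap F f.SplittingField c ≠ 0 := by simpa using hc
    set D := kummerGenerator (algebraMap F f.SplittingField c) r i γ χ
    have hDsq : D ^ 2 = algebraMap F f.SplittingField (kummerSquare a c χ) := by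
      rw [map_kummerSquare]
      exact kummerGenerator_sq hi hγ hr0 hr χ
    have hsq0 : kummerSquare a c χ ≠ 0 := kummerSquare_ne_zero h₁ h₂ hc χ
    have hD0 : D ≠ 0 := by
      intro h0
      rw [h0, zero_pow two_ne_zero, eq_comm, map_eq_zero] at hDsq
      exact hsq0 hDsq
    have hσD (σ : f.Gal) (p : Param)
        (hp : e.permCongrHom.toMonoidHom (Gal.galActionHom f E σ) = p.toPerm) :
        σ D = (bif p.sign χ then -1 else 1) * D :=
      (hdesc σ p hp).map_kummerGenerator hi hγ hr0 hc' (AlgEquiv.commutes σ c) χ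
    have hneg : -D ≠ D := by
      have : CharZero f.SplittingField := charZero_of_injective_algebraMap
        (algebraMap F f.SplittingField).injective
      exact fun h => hD0 (self_eq_neg.mp h.symm)
    constructor
    · intro hχ
      have : IsGalois F f.SplittingField := IsGalois.of_separable_splitting_field hf.separable
      have hbot : D ∈ (⊥ : IntermediateField F f.SplittingField) := by
        rw [IsGalois.mem_bot_iff_fixed]
        intro σ
        obtain ⟨p, -, hp⟩ := h σ
        have := hσD σ p hp
        rw [hχ σ p hp, cond_false, one_mul] at this
        exact this
      obtain ⟨q, hq⟩ := IntermediateField.mem_bot.mp hbot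
      refine ⟨q, (algebraMap F f.SplittingField).injective ?_⟩
      rw [← hDsq, ← hq, map_mul, sq]
    · rintro ⟨q, hq⟩ σ p hp
      have hDq : D = algebraMap F f.SplittingField q ∨ D = -algebraMap F f.SplittingField q := by
        rw [← sq_eq_sq_iff_eq_or_eq_neg, hDsq, hq, map_mul, sq]
      have hfix : σ D = D := by
        have hσq : σ (algebraMap F _ q) = algebraMap F _ q := AlgEquiv.commutes σ q
        rcases hDq with h | h <;> rw [h]
        · exact hσq
        · rw [map_neg, hσq]
      have := hσD σ p hp
      rw [hfix] at this
      cases hs : p.sign χ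
      · rfl
      · rw [hs] at this
        exact absurd (by simpa using this.symm) hneg

end Numbering

/-! ### The Galois group over the rationals -/

theorem exists_shape_of_irreducible {a c : ℚ} (hf : Irreducible (doublyEven a (c * c))) :
    ∃ (e : (doublyEven a (c * c)).rootSet ℂ ≃ Fin 8) (S : Shape), S.Valid ∧
      (∀ g ∈ (galPermGroup (doublyEven a (c * c))).map e.permCongrHom.toMonoidHom,
        ∃ p : Param, g = p.toPerm) ∧
      (∀ p : Param, S.mem p ↔
        p.toPerm ∈ (galPermGroup (doublyEven a (c * c))).map e.permCongrHom.toMonoidHom) ∧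
      (∃ p : Param, S.mem p ∧ p.2.2.1 ∧ p.toPerm * p.toPerm = 1) ∧
      (2 * c - a ≠ 0 → a ^ 2 - 4 * c ^ 2 ≠ 0 → ∀ χ,
        (∀ p : Param, S.mem p → p.sign χ = false) ↔ IsSquare (kummerSquare a c χ)) := by
  generalize hfdef : doublyEven a (c * c) = f at hf ⊢
  obtain ⟨e, h₁, h₂, h₃⟩ := exists_numbering ℂ hfdef.symm hf
  have hmem (g : Perm (Fin 8)) : g ∈ (galPermGroup f).map e.permCongrHom.toMonoidHom ↔
      ∃ σ : f.Gal, e.permCongrHom.toMonoidHom (Gal.galActionHom f ℂ σ) = g := by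
    simp only [galPermGroup, Subgroup.mem_map, MonoidHom.mem_range, exists_exists_eq_and]
  have hG : ∀ g ∈ (galPermGroup f).map e.permCongrHom.toMonoidHom, ∃ p : Param, g = p.toPerm := by
    intro g hg
    obtain ⟨σ, rfl⟩ := (hmem g).1 hg
    exact h₁ σ
  obtain ⟨S, hS, hmemS⟩ := exists_shape _ hG fun n => by
    have := Gal.galAction_isPretransitive f ℂ hf
    obtain ⟨σ, hσ⟩ := MulAction.exists_smul_eq f.Gal (e.symm 0) (e.symm n)
    exact ⟨_, (hmem _).2 ⟨σ, rfl⟩, (congrArg e hσ).trans (e.apply_symm_apply n)⟩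
  refine ⟨e, S, hS, hG, hmemS, ?_, fun h₄ h₅ χ => ?_⟩
  · let τ : ℂ ≃ₐ[ℚ] ℂ := Complex.conjAe.restrictScalars ℚ
    have hτ : τ * τ = 1 := by ext z; exact Complex.conj_conj z
    obtain ⟨p, hp⟩ := h₁ (Gal.restrict f ℂ τ)
    refine ⟨p, (hmemS p).2 ((hmem _).2 ⟨_, hp⟩), h₂ τ p (fun j hj => ?_) hp, ?_⟩
    · intro h
      obtain ⟨x, rfl⟩ := Complex.conj_eq_iff_real.1 h
      have : (x ^ 2 : ℝ) = -1 := by exact_mod_cast hj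
      nlinarith [sq_nonneg x]
    · rw [← hp, ← map_mul, ← map_mul, ← map_mul, hτ, map_one, map_one, map_one]
  · rw [← h₃ h₄ h₅ χ]
    constructor
    · exact fun h σ p hp => h p ((hmemS p).2 ((hmem _).2 ⟨σ, hp⟩))
    · intro h p hp
      obtain ⟨σ, hσ⟩ := (hmem _).1 ((hmemS p).1 hp)
      exact h σ p hσ

theorem galIs_of_map_conj_eq {f : ℚ[X]} {T : Subgroup (Perm (Fin 8))} (e : f.rootSet ℂ ≃ Fin 8)
    (π : Perm (Fin 8)) (h : ((galPermGroup f).map e.permCongrHom.toMonoidHom).map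
      π.permCongrHom.toMonoidHom = T) : GalIs f T := by
  refine ⟨e.trans π, ?_⟩
  rw [← h, Subgroup.map_map]
  rfl

theorem galIs_of_irreducible {a c : ℚ} (hf : Irreducible (doublyEven a (c * c))) :
    GalIs (doublyEven a (c * c)) T2 ∨ GalIs (doublyEven a (c * c)) T3 ∨
      GalIs (doublyEven a (c * c)) T4 ∨ GalIs (doublyEven a (c * c)) T9 ∨
      GalIs (doublyEven a (c * c)) T11 ∨ GalIs (doublyEven a (c * c)) T22 := by
  obtain ⟨e, S, hS, hG, hmem, hconj, -⟩ := exists_shape_of_irreducible hf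
  obtain ⟨π, -, h⟩ := S.conjTo_of_involution hS hconj
  have key {l} (h : S.ConjTo l π) := galIs_of_map_conj_eq e π (h.map_conj_eq hG hmem)
  rw [← closure_gens2, ← closure_gens3, ← closure_gens4, ← closure_gens9, ← closure_gens11,
    ← closure_gens22]
  exact h.imp key (Or.imp key (Or.imp key (Or.imp key (Or.imp key key))))

/-- Conjugation moves `i` and negation fixes it, so they are distinct involutions, whereas `T5` has
only one. -/
theorem not_galIs_T5 {a c : ℚ} (hf : Irreducible (doublyEven a (c * c))) :
    ¬ GalIs (doublyEven a (c * c)) T5 := by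
  rintro ⟨e', he'⟩
  obtain ⟨e, S, -, -, hmem, ⟨p, hp, hps, hpp⟩, -⟩ := exists_shape_of_irreducible hf
  have hz : S.mem (2, false, false, false) := by
    obtain ⟨⟨_, _⟩, ⟨_, _⟩, _, _, _⟩ := S
    simp [Shape.mem, Shape.stab]
  obtain ⟨u, hu, hup⟩ := (hmem _).1 hp
  obtain ⟨v, hv, hvz⟩ := (hmem _).1 hz
  have hinj : Function.Injective e.permCongrHom.toMonoidHom := e.permCongrHom.injective
  have hinj' : Function.Injective e'.permCongrHom.toMonoidHom := e'.permCongrHom.injective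
  have hz2 : Param.toPerm (2, false, false, false) * Param.toPerm (2, false, false, false) = 1 := by
    decide +kernel
  have hone : (1 : Perm (Fin 8)) = Param.toPerm (0, false, false, false) := by decide +kernel
  have key (x : Perm _) (q : Param) (hx : x ∈ galPermGroup (doublyEven a (c * c)))
      (hxq : e.permCongrHom.toMonoidHom x = q.toPerm) (hqq : q.toPerm * q.toPerm = 1)
      (hq : q ≠ (0, false, false, false)) :
      e'.permCongrHom.toMonoidHom x = c[1, 3] * c[2, 0] * c[4, 6] * c[5, 7] := by
    have hxx : x * x = 1 := hinj (by rw [map_mul, hxq, hqq, map_one])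
    refine eq_of_involution_of_mem_T5 (he' ▸ Subgroup.mem_map_of_mem _ hx) ?_ ?_
    · rw [← map_mul, hxx, map_one]
    · intro h
      have hx1 : x = 1 := hinj' (h.trans (map_one _).symm)
      rw [hx1, map_one, hone] at hxq
      exact hq (Param.toPerm_injective hxq).symm
  have huv : u = v := hinj' ((key u p hu hup hpp (by rintro rfl; simp at hps)).trans
    (key v _ hv hvz hz2 (by decide)).symm)
  have hpz : p = (2, false, false, false) := by
    rw [huv] at hup
    exact Param.toPerm_injective (hup.symm.trans hvz)
  simp [hpz] at hps

/-! ### Irreducibility and explicit examples -/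

/-- Generalized Eisenstein at 2: modulo 2 the polynomial is `(x² + x + 1)⁴`, and its remainder by
`x² + x + 1` does not vanish modulo 4. -/
theorem irreducible_doublyEven {a c : ℤ} (ha : a % 4 = 3) (hc : c % 2 = 1) :
    Irreducible (doublyEven (a : ℚ) ((c : ℚ) * (c : ℚ))) := by
  obtain ⟨m, rfl⟩ : ∃ m, a = 4 * m + 3 := ⟨a / 4, by omega⟩
  obtain ⟨n, rfl⟩ : ∃ n, c = 2 * n + 1 := ⟨c / 2, by omega⟩
  set a := 4 * m + 3
  set c := 2 * n + 1
  let f : ℤ[X] := X ^ 8 + C a * X ^ 4 + C (c * c)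
  let q : ℤ[X] := X ^ 2 + X + 1
  have hfm : f.Monic := by
    unfold f
    monicity!
  have hqm : q.Monic := by
    unfold q
    monicity!
  have hmap : doublyEven (a : ℚ) ((c : ℚ) * (c : ℚ)) = f.map (Int.castRingHom ℚ) := by
    simp [f, doublyEven]
  have hdeg : f.natDegree = 8 := natDegree_octic a (c * c)
  rw [hmap, ← IsPrimitive.Int.irreducible_iff_irreducible_map_cast hfm.isPrimitive]
  have hmod : f %ₘ q = C (2 * (2 * m + 1)) * X + C (4 * (n ^ 2 + n)) := by
    -- The quotient comes from `(X - 1) q = X³ - 1`, which gives `X⁸ ≡ X²` and `X⁴ ≡ X` modulo `q`.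
    refine ((div_modByMonic_unique (X ^ 2 * (X ^ 3 + 1) * (X - 1) + C a * (X * (X - 1)) + 1) _ hqm
      ⟨?_, ?_⟩)).2
    · simp only [f, q, a, c]
      simp only [map_add, map_mul, map_pow, map_ofNat, map_one]
      ring
    · have : q.degree = 2 := by unfold q; compute_degree!
      rw [this]
      exact (degree_linear_le).trans_lt (by norm_num)
  refine generalizedEisenstein (K := ZMod 2) (q := q) (p := 4) ?_ hqm hfm.isPrimitive
    (by rw [hdeg]; norm_num) (by simp [hfm.leadingCoeff]) ?_ ?_
  · have hd : (q.map (algebraMap ℤ (ZMod 2))).natDegree = 2 := by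
      rw [hqm.natDegree_map]; unfold q; compute_degree!
    refine (irreducible_iff_roots_eq_zero_of_degree_le_three (by rw [hd])
      (by rw [hd]; norm_num)).2 ?_
    refine Multiset.eq_zero_of_forall_notMem fun x hx => ?_
    have := (mem_roots'.1 hx).2
    simp only [q, IsRoot, Polynomial.map_add, Polynomial.map_pow, map_X, Polynomial.map_one,
      eval_add, eval_pow, eval_X, eval_one] at this
    clear hx
    revert x
    decide
  · have hfq : f = q ^ 4 + C 2 * (-2 * X ^ 7 - 5 * X ^ 6 - 8 * X ^ 5 + C (2 * m - 8) * X ^ 4 -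
        8 * X ^ 3 - 5 * X ^ 2 - 2 * X + C (2 * n ^ 2 + 2 * n)) := by
      simp only [f, q, a, c, map_add, map_sub, map_mul, map_pow, map_ofNat, map_one]
      ring
    rw [hfm.leadingCoeff, map_one, map_one, one_mul, hfq, Polynomial.map_add, Polynomial.map_mul,
      Polynomial.map_pow, Polynomial.map_C, show algebraMap ℤ (ZMod 2) 2 = 0 from rfl, map_zero,
      zero_mul, add_zero]
  · rw [hmod]
    intro h
    -- The linear coefficient `2(2m + 1)` is not divisible by 4; this uses `a ≡ 3 mod 4`.
    have := congrArg (coeff · 1) h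
    simp only [Polynomial.map_add, Polynomial.map_mul, Polynomial.map_C, map_X, coeff_add,
      coeff_C_mul_X, coeff_C, coeff_zero, if_true, one_ne_zero, if_false, add_zero,
      Ideal.Quotient.eq_zero_iff_mem] at this
    have hker : RingHom.ker (algebraMap ℤ (ZMod 2)) = Ideal.span {2} := by
      exact ZMod.ker_intCastRingHom 2
    rw [hker, Ideal.span_singleton_pow, Ideal.mem_span_singleton] at this
    omega

theorem occurs_of_hasRelations {a c : ℤ} (ha : a % 4 = 3) (hc : c % 2 = 1)
    (h₁ : 2 * (c : ℚ) - a ≠ 0) (h₂ : (a : ℚ) ^ 2 - 4 * c ^ 2 ≠ 0)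
    {R : List (Bool × Bool × Bool × Bool)} {l : List (Perm (Fin 8) × ℕ)}
    (hR : ∀ χ, IsSquare (kummerSquare (a : ℚ) c χ) ↔ χ ∈ R)
    (hl : ∀ S : Shape, S.Valid → S.HasRelations R → ∃ π ∈ renumberings, S.ConjTo l π) :
    Occurs (Subgroup.closure {g | ∃ x ∈ l, x.1 = g}) := by
  have hf := irreducible_doublyEven ha hc
  obtain ⟨e, S, hS, hG, hmem, -, hχ⟩ := exists_shape_of_irreducible hf
  obtain ⟨π, -, h⟩ := hl S hS fun χ => (hχ h₁ h₂ χ).trans (hR χ)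
  exact ⟨a, c * c, ⟨c, rfl⟩, hf, galIs_of_map_conj_eq e π (h.map_conj_eq hG hmem)⟩

/-- The four numbers are `-5, 125, -1, 5`, with square products `125 · 5` and `(-5)(-1)5`. -/
theorem occurs_T2 : Occurs T2 :=
  closure_gens2 ▸ occurs_of_hasRelations (a := 15) (c := 5) (by norm_num) (by norm_num)
    (by norm_num) (by norm_num) (by decide +kernel) Shape.conjTo_gens2

/-- The numbers are `3, -3, -1, 1`. -/
theorem occurs_T3 : Occurs T3 :=
  closure_gens3 ▸ occurs_of_hasRelations (a := -1) (c := 1) (by norm_num) (by norm_num)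
    (by norm_num) (by norm_num) (by decide +kernel) Shape.conjTo_gens3

/-- The numbers are `-1, 5, -1, 1`. -/
theorem occurs_T4 : Occurs T4 :=
  closure_gens4 ▸ occurs_of_hasRelations (a := 3) (c := 1) (by norm_num) (by norm_num)
    (by norm_num) (by norm_num) (by decide +kernel) Shape.conjTo_gens4

/-- The numbers are `19, -17 · 19, -1, 9`; only 9 gives a relation. -/
theorem occurs_T9 : Occurs T9 :=
  closure_gens9 ▸ occurs_of_hasRelations (a := -1) (c := 9) (by norm_num) (by norm_num)
    (by norm_num) (by norm_num) (by decide +kernel) Shape.conjTo_gens9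

/-- The numbers are `15, 45, -1, 3`; the one relation is `15 · 45 · 3 = 45²`. -/
theorem occurs_T11 : Occurs T11 :=
  closure_gens11 ▸ occurs_of_hasRelations (a := -9) (c := 3) (by norm_num) (by norm_num)
    (by norm_num) (by norm_num) (by decide +kernel) Shape.conjTo_gens11

/-- The numbers `7, -35, -1, 3` are independent modulo squares. -/
theorem occurs_T22 : Occurs T22 :=
  closure_gens22 ▸ occurs_of_hasRelations (a := -1) (c := 3) (by norm_num) (by norm_num)
    (by norm_num) (by norm_num) (by decide +kernel) Shape.conjTo_gens22

end Octic

theorem theorem3p3 :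
    (∀ a b : ℚ, IsSquare b → Irreducible (Octic.doublyEven a b) →
      (GalIs (Octic.doublyEven a b) Octic.T2 ∨ GalIs (Octic.doublyEven a b) Octic.T3 ∨
        GalIs (Octic.doublyEven a b) Octic.T4 ∨ GalIs (Octic.doublyEven a b) Octic.T9 ∨
        GalIs (Octic.doublyEven a b) Octic.T11 ∨ GalIs (Octic.doublyEven a b) Octic.T22) ∧
      ¬ GalIs (Octic.doublyEven a b) Octic.T5) ∧
    Octic.Occurs Octic.T2 ∧ Octic.Occurs Octic.T3 ∧ Octic.Occurs Octic.T4 ∧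
    Octic.Occurs Octic.T9 ∧ Octic.Occurs Octic.T11 ∧ Octic.Occurs Octic.T22 := by
  refine ⟨?_, Octic.occurs_T2, Octic.occurs_T3, Octic.occurs_T4, Octic.occurs_T9,
    Octic.occurs_T11, Octic.occurs_T22⟩
  rintro a _ ⟨c, rfl⟩ hf
  exact ⟨Octic.galIs_of_irreducible hf, Octic.not_galIs_T5 hf⟩
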